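/- A bivariate copula is a function $C:[0,1]^2\to[0,1]$ with $C(0,v)=C(u,0)=0$, $C(1,v)=v$, $C(u,1)=u$ for all $u,v\in[0,1]$, and $C(u_2,v_2)-C(u_2,v_1)-C(u_1,v_2)+C(u_1,v_1)\ge 0$ whenever $u_1\le u_2$ and $v_1\le v_2$. It is called stochastically increasing (SI), respectively stochastically decreasing (SD), if for every $u\in[0,1]$ the partial derivative $t\mapsto\partial_1 C(t,u)$ with respect to the first argument (which exists for Lebesgue-almost all $t\in(0,1)$) is non-increasing, respectively non-decreasing, outside a Lebesgue-null subset of $(0,1)$. For real random variables $U,V$, write $(U,V)\sim C$ if $P(U\le u,\,V\le v)=C(u,v)$ for all $u,v\in[0,1]$. For a non-degenerate real random variable $Y$ and a random variable $X$, Chatterjee's rank correlation is $$\xi(Y,X)=\frac{\int_{\mathbb R}\operatorname{Var}\big(P(Y\ge y\mid X)\big)\,\mathrm dP^Y(y)}{\int_{\mathbb R}\operatorname{Var}\big(\mathbf 1_{\{Y\ge y\}}\big)\,\mathrm dP^Y(y)},$$ where $P^Y$ denotes the distribution of $Y$. Theorem. Let $(C_n)_{n\in\mathbb N}$ be a sequence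 of bivariate copulas, each of which is SI or SD, that converges pointwise on $[0,1]^2$ to a bivariate copula $C$. Then, for random vectors $(U_n,V_n)\sim C_n$, $n\in\mathbb N$, and $(U,V)\sim C$ (possibly defined on different probability spaces), $$\lim_{n\to\infty}\xi(V_n,U_n)=\xi(V,U).$$ -/

import Mathlib

open MeasureTheory ProbabilityTheory Set Filter Topology

/-- `C` restricts to a bivariate copula on the unit square: grounded, with uniform margins, and
2-increasing. Only the values of `C` on `[0,1] × [0,1]` matter. -/
structure IsBivariateCopula (C : ℝ → ℝ → ℝ) : Prop where
  zero_left : ∀ v ∈ Icc (0 : ℝ) 1, C 0 v = 0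
  zero_right : ∀ u ∈ Icc (0 : ℝ) 1, C u 0 = 0
  one_left : ∀ v ∈ Icc (0 : ℝ) 1, C 1 v = v
  one_right : ∀ u ∈ Icc (0 : ℝ) 1, C u 1 = u
  two_increasing : ∀ u₁ ∈ Icc (0 : ℝ) 1, ∀ u₂ ∈ Icc (0 : ℝ) 1, ∀ v₁ ∈ Icc (0 : ℝ) 1,
    ∀ v₂ ∈ Icc (0 : ℝ) 1, u₁ ≤ u₂ → v₁ ≤ v₂ → 0 ≤ C u₂ v₂ - C u₂ v₁ - C u₁ v₂ + C u₁ v₁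

/-- `C` is stochastically increasing: for every `u ∈ [0,1]` there is a set `S` of full Lebesgue
measure in `(0,1)` on which the partial derivative `t ↦ ∂₁ C(t,u)` exists and is
non-increasing. -/
def IsStochasticallyIncreasing (C : ℝ → ℝ → ℝ) : Prop :=
  ∀ u ∈ Icc (0 : ℝ) 1, ∃ S ⊆ Ioo (0 : ℝ) 1, volume (Ioo (0 : ℝ) 1 \ S) = 0 ∧
    (∀ t ∈ S, DifferentiableAt ℝ (fun s => C s u) t) ∧ AntitoneOn (deriv fun s => C s u) S

/-- `C` is stochastically decreasing: for every `u ∈ [0,1]` there is a set `S` of full Lebesgue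
measure in `(0,1)` on which the partial derivative `t ↦ ∂₁ C(t,u)` exists and is
non-decreasing. -/
def IsStochasticallyDecreasing (C : ℝ → ℝ → ℝ) : Prop :=
  ∀ u ∈ Icc (0 : ℝ) 1, ∃ S ⊆ Ioo (0 : ℝ) 1, volume (Ioo (0 : ℝ) 1 \ S) = 0 ∧
    (∀ t ∈ S, DifferentiableAt ℝ (fun s => C s u) t) ∧ MonotoneOn (deriv fun s => C s u) S

/-- `(U, V) ∼ C`: the joint distribution function of the random vector `(U, V)` is the copula `C`.
For a copula `C` the values on the unit square determine the law of `(U, V)`. -/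
structure HasCopulaLaw {Ω : Type*} [MeasurableSpace Ω] (P : Measure Ω) (U V : Ω → ℝ)
    (C : ℝ → ℝ → ℝ) : Prop where
  measurable_left : Measurable U
  measurable_right : Measurable V
  joint_cdf : ∀ u ∈ Icc (0 : ℝ) 1, ∀ v ∈ Icc (0 : ℝ) 1, P.real {ω | U ω ≤ u ∧ V ω ≤ v} = C u v

/-- Chatterjee's rank correlation
`ξ(Y, X) = (∫ Var(P(Y ≥ y | X)) dP^Y(y)) / (∫ Var(1_{Y ≥ y}) dP^Y(y))`. -/
noncomputable def chatterjeeXi {Ω E : Type*} [MeasurableSpace Ω] [mE : MeasurableSpace E]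
    (P : Measure Ω) (Y : Ω → ℝ) (X : Ω → E) : ℝ :=
  (∫ y, Var[P[{ω | y ≤ Y ω}.indicator (fun _ => (1 : ℝ)) | mE.comap X]; P] ∂(P.map Y)) /
    (∫ y, Var[{ω | y ≤ Y ω}.indicator (fun _ => (1 : ℝ)); P] ∂(P.map Y))

/-! Both margins are uniform, so the denominator of ξ is one constant common to all copulas and the
outer integral in the numerator is over Lebesgue measure on (0,1]. For fixed y, P(V ≥ y | U) = 1 -
p(U), where p is a bounded density of C(·,y) (`HasCopulaLaw.exists_density`), so the integrand is
the variance of p under Lebesgue measure. By dominated convergence, applied in y and in t, it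
suffices that the densities p_n converge to p almost everywhere.

Pointwise convergence of copulas does not give this in general. Under SI or SD, however, C_n(·,y) is
concave or convex, which traps p_n(t) between left and right secant slopes
(`ae_isSandwichedBySlopes_of_antitoneOn`). Secant slopes do converge, and those of the limit
approach p(t) wherever C(·,y) has derivative p(t) (`tendsto_of_isSandwichedBySlopes`). The limit
need only be differentiable almost everywhere. -/

section ConditionalVariance

variable {Ω E : Type*} [mΩ : MeasurableSpace Ω] [mE : MeasurableSpace E] {P : Measure Ω}
  [IsProbabilityMeasure P] {Y : Ω → ℝ} {X : Ω → E}

lemma condExp_indicator_ge_mem_Icc (hX : Measurable X) (hY : Measurable Y) (y : ℝ) :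
    ∀ᵐ ω ∂P, (P[{ω | y ≤ Y ω}.indicator (fun _ => (1 : ℝ)) | mE.comap X]) ω ∈ Icc (0 : ℝ) 1 := by
  have hint : Integrable ({ω | y ≤ Y ω}.indicator (fun _ => (1 : ℝ))) P :=
    (integrable_const 1).indicator (measurableSet_le measurable_const hY)
  have h0 : 0 ≤ᵐ[P] P[{ω | y ≤ Y ω}.indicator (fun _ => (1 : ℝ)) | mE.comap X] :=
    condExp_nonneg (ae_of_all _ fun ω => indicator_nonneg (fun _ _ => zero_le_one) _)
  have h1 := condExp_mono (m := mE.comap X) hint (integrable_const (μ := P) (1 : ℝ))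
    (ae_of_all _ fun ω => indicator_le_self' (fun _ _ => zero_le_one) ω)
  rw [condExp_const hX.comap_le] at h1
  filter_upwards [h0, h1] with ω hω0 hω1
  exact ⟨hω0, hω1⟩

lemma memLp_condExp_indicator_ge (hX : Measurable X) (hY : Measurable Y) (y : ℝ) :
    MemLp (P[{ω | y ≤ Y ω}.indicator (fun _ => (1 : ℝ)) | mE.comap X]) 2 P :=
  memLp_of_bounded (condExp_indicator_ge_mem_Icc hX hY y)
    (stronglyMeasurable_condExp.mono hX.comap_le).aestronglyMeasurable _

/-- The variance need not be monotone in `y`, but the first and second moments are both antitone,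
hence measurable. -/
lemma measurable_variance_condExp_indicator_ge (hX : Measurable X) (hY : Measurable Y) :
    Measurable fun y =>
      Var[P[{ω | y ≤ Y ω}.indicator (fun _ => (1 : ℝ)) | mE.comap X]; P] := by
  have hanti : ∀ y z : ℝ, y ≤ z →
      P[{ω | z ≤ Y ω}.indicator (fun _ => (1 : ℝ)) | mE.comap X] ≤ᵐ[P]
        P[{ω | y ≤ Y ω}.indicator (fun _ => (1 : ℝ)) | mE.comap X] := fun y z hyz =>
    condExp_mono ((integrable_const 1).indicator (measurableSet_le measurable_const hY))
      ((integrable_const 1).indicator (measurableSet_le measurable_const hY))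
      (ae_of_all _ fun ω => indicator_le_indicator_of_subset
        (fun ω (hω : z ≤ Y ω) => hyz.trans hω) (fun _ => zero_le_one) ω)
  simp_rw [fun y => variance_eq_sub (memLp_condExp_indicator_ge (P := P) hX hY y)]
  refine Measurable.sub (Antitone.measurable fun y z hyz => ?_)
    (Measurable.pow_const (Antitone.measurable fun y z hyz => ?_) 2)
  · refine integral_mono_ae (memLp_condExp_indicator_ge hX hY z).integrable_sq
      (memLp_condExp_indicator_ge hX hY y).integrable_sq ?_
    filter_upwards [hanti y z hyz, condExp_indicator_ge_mem_Icc (P := P) hX hY z] with ω h h0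
    exact pow_le_pow_left₀ h0.1 h 2
  · exact integral_mono_ae integrable_condExp integrable_condExp (hanti y z hyz)

lemma variance_condExp_indicator_ge_le_one (hX : Measurable X) (hY : Measurable Y) (y : ℝ) :
    Var[P[{ω | y ≤ Y ω}.indicator (fun _ => (1 : ℝ)) | mE.comap X]; P] ≤ 1 := by
  refine (variance_le_sq_of_bounded (condExp_indicator_ge_mem_Icc hX hY y)
    (stronglyMeasurable_condExp.mono hX.comap_le).measurable.aemeasurable).trans ?_
  norm_num

end ConditionalVariance

/-! ### Uniform margins and conditional densities of a copula -/

lemma map_eq_volume_restrict_Ioc {Ω : Type*} [MeasurableSpace Ω] {P : Measure Ω}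
    [IsProbabilityMeasure P] {X : Ω → ℝ} (hX : Measurable X)
    (h : ∀ x ∈ Icc (0 : ℝ) 1, P.real {ω | X ω ≤ x} = x) :
    P.map X = volume.restrict (Ioc (0 : ℝ) 1) := by
  have hmeas : ∀ x ∈ Icc (0 : ℝ) 1, P {ω | X ω ≤ x} = ENNReal.ofReal x := fun x hx => by
    rw [← ofReal_measureReal, h x hx]
  have : IsProbabilityMeasure (P.map X) := Measure.isProbabilityMeasure_map hX.aemeasurable
  refine Measure.ext_of_Iic _ _ fun a => ?_
  rw [Measure.map_apply hX measurableSet_Iic, Measure.restrict_apply measurableSet_Iic,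
    inter_comm, Ioc_inter_Iic, Real.volume_Ioc]
  change P {ω | X ω ≤ a} = _
  rcases le_total a 0 with ha | ha
  · rw [min_eq_right (ha.trans zero_le_one), sub_zero, ENNReal.ofReal_of_nonpos ha]
    exact measure_mono_null (t := {ω | X ω ≤ 0}) (fun ω hω => le_trans hω ha)
      (by rw [hmeas 0 (by simp), ENNReal.ofReal_zero])
  rcases le_total a 1 with ha1 | ha1
  · rw [min_eq_right ha1, sub_zero, hmeas a ⟨ha, ha1⟩]
  · rw [min_eq_left ha1, sub_zero, ENNReal.ofReal_one]
    refine le_antisymm prob_le_one ?_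
    calc (1 : ENNReal) = P {ω | X ω ≤ 1} := by rw [hmeas 1 (by simp), ENNReal.ofReal_one]
      _ ≤ _ := measure_mono fun ω hω => le_trans hω ha1

section Law

variable {Ω : Type*} [MeasurableSpace Ω] {P : Measure Ω} [IsProbabilityMeasure P]
  {U V : Ω → ℝ} {C : ℝ → ℝ → ℝ}

lemma HasCopulaLaw.ae_le_one (h : HasCopulaLaw P U V C) (hC : IsBivariateCopula C) :
    ∀ᵐ ω ∂P, U ω ≤ 1 ∧ V ω ≤ 1 := by
  have h1 := h.joint_cdf 1 (by simp) 1 (by simp)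
  rw [hC.one_left 1 (by simp)] at h1
  have hm : MeasurableSet {ω | U ω ≤ 1 ∧ V ω ≤ 1} :=
    (measurableSet_le h.measurable_left measurable_const).inter
      (measurableSet_le h.measurable_right measurable_const)
  exact (mem_ae_iff_prob_eq_one hm).2 (by rw [← ofReal_measureReal, h1, ENNReal.ofReal_one])

lemma HasCopulaLaw.measureReal_left_le (h : HasCopulaLaw P U V C) (hC : IsBivariateCopula C)
    {x : ℝ} (hx : x ∈ Icc (0 : ℝ) 1) : P.real {ω | U ω ≤ x} = x := by
  refine (measureReal_congr ?_).trans
    ((h.joint_cdf x hx 1 (by simp)).trans (hC.one_right x hx))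
  filter_upwards [h.ae_le_one hC] with ω hω
  exact propext ⟨fun h => ⟨h, hω.2⟩, fun h => h.1⟩

lemma HasCopulaLaw.measureReal_right_le (h : HasCopulaLaw P U V C) (hC : IsBivariateCopula C)
    {x : ℝ} (hx : x ∈ Icc (0 : ℝ) 1) : P.real {ω | V ω ≤ x} = x := by
  refine (measureReal_congr ?_).trans
    ((h.joint_cdf 1 (by simp) x hx).trans (hC.one_left x hx))
  filter_upwards [h.ae_le_one hC] with ω hω
  exact propext ⟨fun h => ⟨hω.1, h⟩, fun h => h.2⟩

lemma HasCopulaLaw.map_left (h : HasCopulaLaw P U V C) (hC : IsBivariateCopula C) :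
    P.map U = volume.restrict (Ioc (0 : ℝ) 1) :=
  map_eq_volume_restrict_Ioc h.measurable_left fun _ => h.measureReal_left_le hC

lemma HasCopulaLaw.map_right (h : HasCopulaLaw P U V C) (hC : IsBivariateCopula C) :
    P.map V = volume.restrict (Ioc (0 : ℝ) 1) :=
  map_eq_volume_restrict_Ioc h.measurable_right fun _ => h.measureReal_right_le hC

lemma HasCopulaLaw.measureReal_Ioc_Ici (h : HasCopulaLaw P U V C) (hC : IsBivariateCopula C)
    {a b v : ℝ} (ha : 0 ≤ a) (hab : a ≤ b) (hb : b ≤ 1) (hv : v ∈ Icc (0 : ℝ) 1) :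
    P.real (U ⁻¹' Ioc a b ∩ {ω | v ≤ V ω}) = (b - a) - (C b v - C a v) := by
  have hU (s : ℝ) : MeasurableSet {ω | U ω ≤ s} :=
    measurableSet_le h.measurable_left measurable_const
  have hV : MeasurableSet {ω | V ω ≤ v} := measurableSet_le h.measurable_right measurable_const
  have key : ∀ s ∈ Icc (0 : ℝ) 1,
      P.real ({ω | U ω ≤ s} \ {ω | U ω ≤ s ∧ V ω ≤ v}) = s - C s v := fun s hs => by
    have hsub : {ω | U ω ≤ s ∧ V ω ≤ v} ⊆ {ω | U ω ≤ s} := fun ω hω => hω.1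
    rw [measureReal_sdiff hsub ((hU s).inter hV), h.measureReal_left_le hC hs,
      h.joint_cdf s hs v hv]
  -- `V` has no atoms, so `v ≤ V` may be replaced by `v < V`, the complement of the event in the
  -- joint cdf.
  have hne : ∀ᵐ ω ∂P, V ω ≠ v := by
    have : ∀ᵐ y ∂(P.map V), y ≠ v := by
      rw [h.map_right hC]; exact Measure.ae_ne _ v
    exact ae_of_ae_map h.measurable_right.aemeasurable this
  have hdiff : (U ⁻¹' Ioc a b ∩ {ω | v ≤ V ω} : Set Ω) =ᵐ[P]
      (({ω | U ω ≤ b} \ {ω | U ω ≤ b ∧ V ω ≤ v}) \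
        ({ω | U ω ≤ a} \ {ω | U ω ≤ a ∧ V ω ≤ v}) : Set Ω) := by
    filter_upwards [hne] with ω hω
    apply propext
    change (a < U ω ∧ U ω ≤ b) ∧ v ≤ V ω ↔
      (U ω ≤ b ∧ ¬ (U ω ≤ b ∧ V ω ≤ v)) ∧ ¬ (U ω ≤ a ∧ ¬ (U ω ≤ a ∧ V ω ≤ v))
    grind
  rw [measureReal_congr hdiff, measureReal_sdiff, key b ⟨ha.trans hab, hb⟩,
    key a ⟨ha, hab.trans hb⟩]
  · ring
  · intro ω hω
    have h1 : U ω ≤ a ∧ ¬ (U ω ≤ a ∧ V ω ≤ v) := hω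
    change U ω ≤ b ∧ ¬ (U ω ≤ b ∧ V ω ≤ v)
    grind
  · exact (hU a).diff ((hU a).inter hV)

/-- `p` is a version of `t ↦ P(V ≤ v | U = t)`, obtained by factoring the conditional expectation
through `U`. -/
lemma HasCopulaLaw.exists_density (h : HasCopulaLaw P U V C) (hC : IsBivariateCopula C)
    {v : ℝ} (hv : v ∈ Icc (0 : ℝ) 1) :
    ∃ p : ℝ → ℝ, Measurable p ∧ (∀ t, p t ∈ Icc (0 : ℝ) 1) ∧
      P[{ω | v ≤ V ω}.indicator (fun _ => (1 : ℝ)) | MeasurableSpace.comap U inferInstance]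
        =ᵐ[P] (fun ω => 1 - p (U ω)) ∧
      ∀ a b, 0 ≤ a → a ≤ b → b ≤ 1 → ∫ t in a..b, p t = C b v - C a v := by
  have hm : MeasurableSpace.comap U inferInstance ≤ ‹MeasurableSpace Ω› :=
    h.measurable_left.comap_le
  have hVm : MeasurableSet {ω | v ≤ V ω} := measurableSet_le measurable_const h.measurable_right
  have hint : Integrable ({ω | v ≤ V ω}.indicator (fun _ => (1 : ℝ))) P :=
    (integrable_const 1).indicator hVm
  obtain ⟨g, hg, hgU⟩ := (stronglyMeasurable_condExp (μ := P)
    (f := {ω | v ≤ V ω}.indicator (fun _ => (1 : ℝ)))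
    (m := MeasurableSpace.comap U inferInstance)).measurable.exists_eq_measurable_comp
  obtain ⟨p, hp, hpb, hcond⟩ : ∃ p : ℝ → ℝ, Measurable p ∧ (∀ t, p t ∈ Icc (0 : ℝ) 1) ∧
      P[{ω | v ≤ V ω}.indicator (fun _ => (1 : ℝ)) | MeasurableSpace.comap U inferInstance]
        =ᵐ[P] (fun ω => 1 - p (U ω)) := by
    -- Clamping to [0,1] makes the bounds hold everywhere and changes nothing almost surely.
    refine ⟨fun t => 1 - max 0 (min 1 (g t)), by fun_prop, fun t => by constructor <;> grind, ?_⟩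
    filter_upwards [condExp_indicator_ge_mem_Icc h.measurable_left h.measurable_right v]
      with ω ⟨hω0, hω1⟩
    have := congrFun hgU ω
    rw [Function.comp_apply] at this
    rw [sub_sub_cancel, ← this, min_eq_right hω1, max_eq_right hω0]
  refine ⟨p, hp, hpb, hcond, fun a b ha hab hb => ?_⟩
  have hsub : Ioc a b ⊆ Ioc 0 1 := Ioc_subset_Ioc ha hb
  have hpint : IntervalIntegrable p volume a b := by
    rw [intervalIntegrable_iff_integrableOn_Ioc_of_le hab]
    exact Measure.integrableOn_of_bounded (M := 1) (by simp) hp.aestronglyMeasurable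
      (ae_of_all _ fun t => by rw [Real.norm_of_nonneg (hpb t).1]; exact (hpb t).2)
  have e : ∫ t in a..b, (1 - p t) = (b - a) - (C b v - C a v) := by
    rw [← h.measureReal_Ioc_Ici hC ha hab hb hv, intervalIntegral.integral_of_le hab,
      ← Measure.restrict_restrict_of_subset hsub, ← h.map_left hC,
      setIntegral_map measurableSet_Ioc (by fun_prop) h.measurable_left.aemeasurable]
    rw [← setIntegral_congr_ae (h.measurable_left measurableSet_Ioc) (hcond.mono fun ω h _ => h),
      setIntegral_condExp hm hint ⟨_, measurableSet_Ioc, rfl⟩, setIntegral_indicator hVm]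
    simp
  rw [intervalIntegral.integral_sub (by simp) hpint] at e
  simp at e
  linarith

end Law

/-! ### Derivatives and secant slopes -/

lemma ae_hasDerivAt_of_integral_eq {f p : ℝ → ℝ} (hp : IntervalIntegrable p volume 0 1)
    (hf : ∀ a b, 0 ≤ a → a ≤ b → b ≤ 1 → ∫ t in a..b, p t = f b - f a) :
    ∀ᵐ t, t ∈ Ioo (0 : ℝ) 1 → HasDerivAt f (p t) t := by
  filter_upwards [hp.ae_hasDerivAt_integral] with t ht hmem
  rw [uIcc_of_le zero_le_one] at ht
  have h := (ht (Ioo_subset_Icc_self hmem) 0 (by simp)).add_const (f 0)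
  refine h.congr_of_eventuallyEq ?_
  filter_upwards [isOpen_Ioo.mem_nhds hmem] with s hs
  rw [hf 0 s le_rfl hs.1.le hs.2.le, sub_add_cancel]

/-- `d` lies between the secant slopes at `t` from the left and from the right within `[0, 1]`. -/
def IsSandwichedBySlopes (f : ℝ → ℝ) (t d : ℝ) : Prop :=
  ∀ a ∈ Icc (0 : ℝ) 1, ∀ b ∈ Icc (0 : ℝ) 1, a < t → t < b → d ∈ uIcc (slope f t a) (slope f t b)

/-- Slopes are averages of `p` over [a,t] and [t,b]; as `p` is almost everywhere non-increasing, `p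
t` bounds these averages from below and above respectively. -/
lemma ae_isSandwichedBySlopes_of_antitoneOn {f p : ℝ → ℝ}
    (hp : IntervalIntegrable p volume 0 1)
    (hf : ∀ a b, 0 ≤ a → a ≤ b → b ≤ 1 → ∫ t in a..b, p t = f b - f a)
    {S : Set ℝ} (hS : volume (Ioo (0 : ℝ) 1 \ S) = 0) (hanti : AntitoneOn (deriv f) S) :
    ∀ᵐ t, t ∈ Ioo (0 : ℝ) 1 → IsSandwichedBySlopes f t (p t) := by
  have hS' : ∀ᵐ t, t ∈ Ioo (0 : ℝ) 1 → t ∈ S := by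
    rw [ae_iff]; convert hS using 2; ext t; simp [and_assoc]
  have hd := ae_hasDerivAt_of_integral_eq hp hf
  have hsub {x y : ℝ} (hx : 0 ≤ x) (hxy : x ≤ y) (hy : y ≤ 1) :
      IntervalIntegrable p volume x y :=
    hp.mono_set (by rw [uIcc_of_le hxy, uIcc_of_le zero_le_one]; exact Icc_subset_Icc hx hy)
  filter_upwards [hS', hd] with t htS htd ht a ha b hb hat htb
  have hle : ∀ᵐ s, s ∈ Ioo (0 : ℝ) 1 → s ≤ t → p t ≤ p s := by
    filter_upwards [hS', hd] with s hsS hsd hs hst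
    rw [← (hsd hs).deriv, ← (htd ht).deriv]
    exact hanti (hsS hs) (htS ht) hst
  have hge : ∀ᵐ s, s ∈ Ioo (0 : ℝ) 1 → t ≤ s → p s ≤ p t := by
    filter_upwards [hS', hd] with s hsS hsd hs hst
    rw [← (hsd hs).deriv, ← (htd ht).deriv]
    exact hanti (htS ht) (hsS hs) hst
  -- When `a = 0` or `b = 1` the interval leaves (0,1) at a single point, which is null.
  have hne1 : ∀ᵐ s : ℝ, s ≠ 1 := Measure.ae_ne _ _
  have hne0 : ∀ᵐ s : ℝ, s ≠ 0 := Measure.ae_ne _ _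
  have h1 : p t * (t - a) ≤ f t - f a := by
    rw [← hf a t ha.1 hat.le ht.2.le, mul_comm, ← smul_eq_mul, ← intervalIntegral.integral_const]
    refine intervalIntegral.integral_mono_ae_restrict hat.le (by simp)
      (hsub ha.1 hat.le ht.2.le) ?_
    rw [EventuallyLE, ae_restrict_iff' measurableSet_Icc]
    filter_upwards [hle, hne0] with s hs hs0 hmem
    exact hs ⟨lt_of_le_of_ne (ha.1.trans hmem.1) hs0.symm, hmem.2.trans_lt ht.2⟩ hmem.2
  have h2 : f b - f t ≤ p t * (b - t) := by
    rw [← hf t b ht.1.le htb.le hb.2, mul_comm, ← smul_eq_mul, ← intervalIntegral.integral_const]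
    refine intervalIntegral.integral_mono_ae_restrict htb.le
      (hsub ht.1.le htb.le hb.2) (by simp) ?_
    rw [EventuallyLE, ae_restrict_iff' measurableSet_Icc]
    filter_upwards [hge, hne1] with s hs hs1 hmem
    exact hs ⟨ht.1.trans_le hmem.1, lt_of_le_of_ne (hmem.2.trans hb.2) hs1⟩ hmem.1
  refine mem_uIcc.2 (Or.inr ⟨?_, ?_⟩)
  · rwa [slope_def_field, div_le_iff₀ (sub_pos.2 htb)]
  · rwa [slope_comm, slope_def_field, le_div_iff₀ (sub_pos.2 hat)]

lemma ae_isSandwichedBySlopes_of_monotoneOn {f p : ℝ → ℝ}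
    (hp : IntervalIntegrable p volume 0 1)
    (hf : ∀ a b, 0 ≤ a → a ≤ b → b ≤ 1 → ∫ t in a..b, p t = f b - f a)
    {S : Set ℝ} (hS : volume (Ioo (0 : ℝ) 1 \ S) = 0) (hmono : MonotoneOn (deriv f) S) :
    ∀ᵐ t, t ∈ Ioo (0 : ℝ) 1 → IsSandwichedBySlopes f t (p t) := by
  have hanti : AntitoneOn (deriv fun s => -f s) S := by
    intro x hx y hy hxy
    simpa [deriv.fun_neg] using hmono hx hy hxy
  filter_upwards [ae_isSandwichedBySlopes_of_antitoneOn (p := fun t => -p t) hp.neg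
    (fun a b ha hab hb => by rw [intervalIntegral.integral_neg, hf a b ha hab hb]; ring)
    hS hanti] with t h ht a ha b hb hat htb
  have := h ht a ha b hb hat htb
  simp only [slope_def_field, mem_uIcc] at this ⊢
  have e (x y z : ℝ) : (-x - -y) / z = -((x - y) / z) := by ring
  rw [e, e] at this
  grind

/-- Fix `a` and `b` so close to `t` that both slopes of `f` are within ε of `d`; for large `n` the
slopes of `f_seq n` are too, and so is anything between them. The unordered interval serves concave
and convex functions alike, so the type may vary with `n`. -/
lemma tendsto_of_isSandwichedBySlopes {f : ℝ → ℝ} {f_seq : ℕ → ℝ → ℝ} {t d : ℝ} {d_seq : ℕ → ℝ}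
    (ht : t ∈ Ioo (0 : ℝ) 1) (hf : HasDerivAt f d t)
    (hlim : ∀ s ∈ Icc (0 : ℝ) 1, Tendsto (fun n => f_seq n s) atTop (𝓝 (f s)))
    (hd : ∀ n, IsSandwichedBySlopes (f_seq n) t (d_seq n)) :
    Tendsto d_seq atTop (𝓝 d) := by
  rw [hasDerivAt_iff_tendsto_slope_left_right] at hf
  rw [(nhds_basis_Ioo_pos d).tendsto_right_iff]
  intro ε hε
  have hmem : Ioo (d - ε) (d + ε) ∈ 𝓝 d := Ioo_mem_nhds (by linarith) (by linarith)
  obtain ⟨a, ha, ha0, hat⟩ := ((hf.1.eventually hmem).and (Ioo_mem_nhdsLT ht.1)).exists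
  obtain ⟨b, hb, htb, hb1⟩ := ((hf.2.eventually hmem).and (Ioo_mem_nhdsGT ht.2)).exists
  have haI : a ∈ Icc (0 : ℝ) 1 := ⟨ha0.le, (hat.trans ht.2).le⟩
  have hbI : b ∈ Icc (0 : ℝ) 1 := ⟨(ht.1.trans htb).le, hb1.le⟩
  have hslope : ∀ c ∈ Icc (0 : ℝ) 1,
      Tendsto (fun n => slope (f_seq n) t c) atTop (𝓝 (slope f t c)) := fun c hc => by
    simp only [slope_def_field]
    exact ((hlim c hc).sub (hlim t (Ioo_subset_Icc_self ht))).div_const _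
  filter_upwards [(hslope a haI).eventually (isOpen_Ioo.mem_nhds ha),
    (hslope b hbI).eventually (isOpen_Ioo.mem_nhds hb)] with n hna hnb
  exact ordConnected_Ioo.uIcc_subset hna hnb (hd n a haI b hbI hat htb)

/-! ### Convergence of variances and of ξ -/

instance isProbabilityMeasure_volume_restrict_Ioc :
    IsProbabilityMeasure (volume.restrict (Ioc (0 : ℝ) 1)) := ⟨by simp⟩

lemma tendsto_variance_of_ae_tendsto {Ω : Type*} [MeasurableSpace Ω] {μ : Measure Ω}
    [IsProbabilityMeasure μ] {p : Ω → ℝ} {p_seq : ℕ → Ω → ℝ}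
    (hm : Measurable p) (hm_seq : ∀ n, Measurable (p_seq n))
    (hp : ∀ t, p t ∈ Icc (0 : ℝ) 1) (hp_seq : ∀ n t, p_seq n t ∈ Icc (0 : ℝ) 1)
    (hlim : ∀ᵐ t ∂μ, Tendsto (fun n => p_seq n t) atTop (𝓝 (p t))) :
    Tendsto (fun n => Var[p_seq n; μ]) atTop (𝓝 Var[p; μ]) := by
  have hv {q : Ω → ℝ} (hq : Measurable q) (hb : ∀ t, q t ∈ Icc (0 : ℝ) 1) :
      Var[q; μ] = μ[q ^ 2] - μ[q] ^ 2 :=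
    variance_eq_sub (memLp_of_bounded (ae_of_all _ hb) hq.aestronglyMeasurable _)
  simp_rw [hv hm hp, fun n => hv (hm_seq n) (hp_seq n)]
  refine Tendsto.sub ?_ (Tendsto.pow ?_ 2)
  · refine tendsto_integral_of_dominated_convergence (fun _ => 1)
      (fun n => ((hm_seq n).pow_const 2).aestronglyMeasurable) (integrable_const _)
      (fun n => ae_of_all _ fun t => ?_) (hlim.mono fun t ht => ht.pow 2)
    rw [Pi.pow_apply, Real.norm_of_nonneg (sq_nonneg _)]
    exact pow_le_one₀ (hp_seq n t).1 (hp_seq n t).2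
  · refine tendsto_integral_of_dominated_convergence (fun _ => 1)
      (fun n => (hm_seq n).aestronglyMeasurable) (integrable_const _)
      (fun n => ae_of_all _ fun t => ?_) hlim
    rw [Real.norm_of_nonneg (hp_seq n t).1]
    exact (hp_seq n t).2

lemma HasCopulaLaw.variance_condExp_eq {Ω : Type*} [MeasurableSpace Ω] {P : Measure Ω}
    [IsProbabilityMeasure P] {U V : Ω → ℝ} {C : ℝ → ℝ → ℝ} (h : HasCopulaLaw P U V C)
    (hC : IsBivariateCopula C) {f : Ω → ℝ} {p : ℝ → ℝ} (hp : Measurable p)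
    (hf : f =ᵐ[P] fun ω => 1 - p (U ω)) :
    Var[f; P] = Var[p; volume.restrict (Ioc (0 : ℝ) 1)] := by
  have hpU : Measurable fun ω => p (U ω) := hp.comp h.measurable_left
  rw [variance_congr hf, variance_const_sub hpU.aestronglyMeasurable, ← h.map_left hC,
    variance_map hp.aemeasurable h.measurable_left.aemeasurable]
  rfl

lemma HasCopulaLaw.variance_indicator_ge_eq {Ω : Type*} [MeasurableSpace Ω] {P : Measure Ω}
    [IsProbabilityMeasure P] {U V : Ω → ℝ} {C : ℝ → ℝ → ℝ} (h : HasCopulaLaw P U V C)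
    (hC : IsBivariateCopula C) (y : ℝ) :
    Var[{ω | y ≤ V ω}.indicator (fun _ => (1 : ℝ)); P] =
      Var[(Ici y).indicator (fun _ => (1 : ℝ)); volume.restrict (Ioc (0 : ℝ) 1)] := by
  rw [← h.map_right hC, variance_map (by fun_prop (disch := exact measurableSet_Ici))
    h.measurable_right.aemeasurable]
  rfl

theorem mainTheorem10
    (C_seq : ℕ → ℝ → ℝ → ℝ) (C : ℝ → ℝ → ℝ)
    (hC_seq : ∀ n, IsBivariateCopula (C_seq n)) (hC : IsBivariateCopula C)
    (hSI : ∀ n, IsStochasticallyIncreasing (C_seq n) ∨ IsStochasticallyDecreasing (C_seq n))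
    (hlim : ∀ u ∈ Icc (0 : ℝ) 1, ∀ v ∈ Icc (0 : ℝ) 1,
      Tendsto (fun n => C_seq n u v) atTop (𝓝 (C u v)))
    {Ω_seq : ℕ → Type*} [∀ n, MeasurableSpace (Ω_seq n)]
    (P_seq : ∀ n, Measure (Ω_seq n)) [∀ n, IsProbabilityMeasure (P_seq n)]
    (U_seq V_seq : ∀ n, Ω_seq n → ℝ)
    (hUV_seq : ∀ n, HasCopulaLaw (P_seq n) (U_seq n) (V_seq n) (C_seq n))
    {Ω : Type*} [MeasurableSpace Ω] (P : Measure Ω) [IsProbabilityMeasure P]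
    (U V : Ω → ℝ) (hUV : HasCopulaLaw P U V C) :
    Tendsto (fun n => chatterjeeXi (P_seq n) (V_seq n) (U_seq n)) atTop
      (𝓝 (chatterjeeXi P V U)) := by
  unfold chatterjeeXi
  simp_rw [fun n => (hUV_seq n).map_right (hC_seq n), hUV.map_right hC,
    fun n => (hUV_seq n).variance_indicator_ge_eq (hC_seq n), hUV.variance_indicator_ge_eq hC]
  refine Tendsto.div_const ?_ _
  refine tendsto_integral_of_dominated_convergence (fun _ => 1)
    (fun n => (measurable_variance_condExp_indicator_ge (hUV_seq n).measurable_left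
      (hUV_seq n).measurable_right).aestronglyMeasurable) (integrable_const _)
    (fun n => ae_of_all _ fun y => ?_) ?_
  · rw [Real.norm_of_nonneg (variance_nonneg _ _)]
    exact variance_condExp_indicator_ge_le_one (hUV_seq n).measurable_left
      (hUV_seq n).measurable_right y
  filter_upwards [ae_restrict_mem measurableSet_Ioc] with y hy
  have hy' := Ioc_subset_Icc_self hy
  obtain ⟨p, hp, hpb, hcond, hpint⟩ := hUV.exists_density hC hy'
  choose p_seq hp_seq hpb_seq hcond_seq hpint_seq using
    fun n => (hUV_seq n).exists_density (hC_seq n) hy'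
  rw [hUV.variance_condExp_eq hC hp hcond]
  simp_rw [fun n => (hUV_seq n).variance_condExp_eq (hC_seq n) (hp_seq n) (hcond_seq n)]
  refine tendsto_variance_of_ae_tendsto hp hp_seq hpb hpb_seq ?_
  have hii {q : ℝ → ℝ} (hq : Measurable q) (hb : ∀ t, q t ∈ Icc (0 : ℝ) 1) :
      IntervalIntegrable q volume 0 1 := by
    rw [intervalIntegrable_iff_integrableOn_Ioc_of_le zero_le_one]
    exact (memLp_of_bounded (ae_of_all _ hb) hq.aestronglyMeasurable 1).integrable le_rfl
  have hsand : ∀ᵐ t, ∀ n, t ∈ Ioo (0 : ℝ) 1 →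
      IsSandwichedBySlopes (fun s => C_seq n s y) t (p_seq n t) := by
    -- Countably many exceptional null sets, one for each `n`, are merged into one.
    refine ae_all_iff.2 fun n => ?_
    rcases hSI n with h | h
    · obtain ⟨S, -, hS, -, hanti⟩ := h y hy'
      exact ae_isSandwichedBySlopes_of_antitoneOn (hii (hp_seq n) (hpb_seq n)) (hpint_seq n)
        hS hanti
    · obtain ⟨S, -, hS, -, hmono⟩ := h y hy'
      exact ae_isSandwichedBySlopes_of_monotoneOn (hii (hp_seq n) (hpb_seq n)) (hpint_seq n)
        hS hmono
  rw [← Measure.restrict_congr_set Ioo_ae_eq_Ioc, ae_restrict_iff' measurableSet_Ioo]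
  filter_upwards [hsand, ae_hasDerivAt_of_integral_eq (f := fun s => C s y) (hii hp hpb) hpint]
    with t ht hd htI
  exact tendsto_of_isSandwichedBySlopes htI (hd htI) (fun s hs => hlim s hs y hy')
    fun n => ht n htI
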